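/- Let $K$ and $L$ be compact lines, i.e. linearly ordered sets that are compact in their order topology, let $q:K\to L$ be an order-preserving (that is, $x\le y$ implies $q(x)\le q(y)$) continuous surjection, and let $C(K)$, $C(L)$ be the Banach spaces of continuous scalar (real or complex) functions with the supremum norm. Put $q^*C(L)=\{f\circ q: f\in C(L)\}\subseteq C(K)$. A point $x$ of a compact line is *internal* if it is isolated neither in $[x,\to)$ nor in $(\leftarrow,x]$. For a linearly ordered set $X$ and $A\subseteq X$, the internal order is defined as follows: $\mathrm{io}(x,A)\ge 0$ for each $x\in A$; for $n\ge 1$ and $x\in A$, $\mathrm{io}(x,A)\ge n$ if the sets $A^-=\{y\in A: y<x,\ \mathrm{io}(y,A)\ge n-1\}$ and $A^+=\{y\in A: y>x,\ \mathrm{io}(y,A)\ge n-1\}$ are nonempty and $\sup A^-=\inf A^+=x$. Let $\mathrm{io}(x,A)\in\{0,1,2,\dots,\infty\}$ be the supremum of all $n\ge 0$ with $\mathrm{io}(x,A)\ge n$; let $\mathrm{io}(A)=\sup_{x\in A}\mathrm{io}(x,A)$ if $A\neq\emptyset$ and $\mathrm{io}(\emptyset)=-1$. A projection is a bounded linear idempotent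 operator; a subspace of a Banach space is complemented if it is the range of a projection, and $1$-complemented if it is the range of a projection of norm at most $1$. A regular averaging operator for $q$ is a bounded linear operator $T:C(K)\to C(L)$ with $T(f\circ q)=f$ for all $f\in C(L)$, $T1=1$, and $Tf\ge 0$ whenever $f\ge 0$. Set $Q=\{x\in L: x \text{ is an internal point of } L \text{ and } |q^{-1}(x)|>1\}$. Then: 1. $q^*C(L)$ is $1$-complemented in $C(K)$ if and only if $Q=\emptyset$. In this case there is a continuous map $i:L\to K$ with $q\circ i=\mathrm{id}_L$, and $q$ admits a regular averaging operator. 2. $q^*C(L)$ is complemented in $C(K)$ if and only if $\mathrm{io}(Q)<\infty$. More specifically, for every integer $n\ge -1$: - (a) if $K\ne\emptyset$ and $\mathrm{io}(Q)\ge n$, then every projection $P$ of $C(K)$ onto $q^*C(L)$ satisfies $\|P\|\ge 2+\left\lceil\frac{n-1}{2}\right\rceil$ (for $n\ge 0$ the condition $K\neq\emptyset$ is automatic); - (b) if $\mathrm{io}(Q)\le n$, then there is a projection $P$ of $C(K)$ onto $q^*C(L)$ with $\|P\|\le 2n+3$. -/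

import Mathlib

open Set

namespace CompactLine

/-- `x` is an isolated point of the subspace `S`. -/
def IsIsolatedIn {X : Type*} [TopologicalSpace X] (x : X) (S : Set X) : Prop :=
  ∃ U : Set X, IsOpen U ∧ U ∩ S = {x}

/-- `x` is external if it is isolated in `[x, →)` or in `(←, x]`. -/
def IsExternal {X : Type*} [LinearOrder X] [TopologicalSpace X] (x : X) : Prop :=
  IsIsolatedIn x (Ici x) ∨ IsIsolatedIn x (Iic x)

/-- `x` is internal if it is not external. -/
def IsInternal {X : Type*} [LinearOrder X] [TopologicalSpace X] (x : X) : Prop :=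
  ¬ IsExternal x

/-- `PointOrderGE A n x` is the relation `io(x, A) ≥ n` (for `x ∈ A`). -/
def PointOrderGE {X : Type*} [LinearOrder X] (A : Set X) : ℕ → X → Prop
  | 0, x => x ∈ A
  | n + 1, x => x ∈ A ∧
      {y | y ∈ A ∧ y < x ∧ PointOrderGE A n y}.Nonempty ∧
      {y | y ∈ A ∧ x < y ∧ PointOrderGE A n y}.Nonempty ∧
      IsLUB {y | y ∈ A ∧ y < x ∧ PointOrderGE A n y} x ∧
      IsGLB {y | y ∈ A ∧ x < y ∧ PointOrderGE A n y} x

/-- The internal order `io(x, A)` of a point `x ∈ A`, with values in `ℕ ∪ {∞}`. -/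
noncomputable def pointOrder {X : Type*} [LinearOrder X] (A : Set X) (x : X) : ℕ∞ :=
  sSup {k : ℕ∞ | ∃ n : ℕ, PointOrderGE A n x ∧ k = n}

open Classical in
/-- The internal order `io(A)` of a subset `A` of a linearly ordered set, with values in
`{-1} ∪ ℕ ∪ {∞} ⊆ ℤ ∪ {∞}`: it is `-1` for `A = ∅` and `sup {io(x, A) : x ∈ A}` otherwise. -/
noncomputable def internalOrder {X : Type*} [LinearOrder X] (A : Set X) : WithTop ℤ :=
  if A = ∅ then ((-1 : ℤ) : WithTop ℤ)
  else ENat.map (fun n : ℕ => (n : ℤ)) (sSup (pointOrder A '' A))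

/-- The set of internal points of `L` whose fiber under `q` has more than one point. -/
def internalNontrivialFibers {K L : Type*} [LinearOrder L] [TopologicalSpace L] (q : K → L) :
    Set L :=
  {x | IsInternal x ∧ (q ⁻¹' {x}).Nontrivial}

/-- The subspace `q^*C(L) = {f ∘ q : f ∈ C(L)}` of `C(K)`. -/
def pullback (𝕜 : Type*) [RCLike 𝕜] {K L : Type*} [TopologicalSpace K] [TopologicalSpace L]
    (q : C(K, L)) : Submodule 𝕜 C(K, 𝕜) :=
  LinearMap.range (ContinuousMap.compRightAlgHom 𝕜 𝕜 q).toLinearMap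

/-- `P` is a bounded linear projection of `E` onto the subspace `S`. -/
def IsProjectionOnto {𝕜 E : Type*} [RCLike 𝕜] [NormedAddCommGroup E] [NormedSpace 𝕜 E]
    (P : E →L[𝕜] E) (S : Submodule 𝕜 E) : Prop :=
  P.comp P = P ∧ LinearMap.range (P : E →ₗ[𝕜] E) = S

/-- `S` is complemented in `E`. -/
def IsComplemented {𝕜 E : Type*} [RCLike 𝕜] [NormedAddCommGroup E] [NormedSpace 𝕜 E]
    (S : Submodule 𝕜 E) : Prop :=
  ∃ P : E →L[𝕜] E, IsProjectionOnto P S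

/-- `S` is `c`-complemented in `E`: it is the range of a projection of norm at most `c`. -/
def IsComplementedWith {𝕜 E : Type*} [RCLike 𝕜] [NormedAddCommGroup E] [NormedSpace 𝕜 E]
    (c : ℝ) (S : Submodule 𝕜 E) : Prop :=
  ∃ P : E →L[𝕜] E, IsProjectionOnto P S ∧ ‖P‖ ≤ c

/-- `f` takes only nonnegative real values. -/
def IsNonneg {𝕜 X : Type*} [RCLike 𝕜] [TopologicalSpace X] (f : C(X, 𝕜)) : Prop :=
  ∀ x, 0 ≤ RCLike.re (f x) ∧ RCLike.im (f x) = 0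

/-- `T` is a regular averaging operator for `q`: a bounded linear operator `C(K) → C(L)` with
`T (f ∘ q) = f` for all `f ∈ C(L)`, which is positive and satisfies `T 1 = 1`. -/
def IsRegularAveraging {𝕜 K L : Type*} [RCLike 𝕜] [TopologicalSpace K] [CompactSpace K]
    [TopologicalSpace L] [CompactSpace L] (q : C(K, L)) (T : C(K, 𝕜) →L[𝕜] C(L, 𝕜)) : Prop :=
  (∀ f : C(L, 𝕜), T (f.comp q) = f) ∧ T 1 = 1 ∧ ∀ f : C(K, 𝕜), IsNonneg f → IsNonneg (T f)

end CompactLine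

open Filter Topology

namespace CompactLine

/-! ### Internal points and internal order -/

section Order

variable {X : Type*} [LinearOrder X]

/-! As `q` is surjective, projections onto the pullback correspond to averaging operators `T : C(K)
→ C(L)` with `T (g ∘ q) = g`.

Lower estimate (`exists_deviation_step`, `two_sub_re_le`, `add_three_sub_re_le`): let `f` in the
unit ball equal `1` on all fibers near `x ∈ Q`. A bump around `x` splits into two halves, cut
between two points of the fiber of `x`; `T` gives one half real part at least `1/2` at `x`.
Subtracting twice that half stays in the unit ball, lowers `re (T f x)` by at least `1`, and leaves
`f = 1` on the fibers close to `x` on one side. Moving to a point of lower order on that side, the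
step repeats: order `n` allows `n + 1` steps up to `ε`, and subtracting twice a full bump at the end
gains `2`. Starting from `f = 1` gives `n + 2 ≤ ‖P‖`, which for `n ≥ 0` implies the stated bound.

Upper estimate (`exists_pairwiseDisjoint_intervals`, `continuous_corrected_section`): a section `i`
of `q` can be chosen to be discontinuous only at points of `Q`, where it jumps from the least point
`a y` to the greatest point `b y` of the fiber. Subtracting `h_y (f (b y) - f (a y))` from `f ∘ i`,
with `h_y` a unit jump at `y` supported on one side of `y`, removes the jump and changes nothing if
`f = g ∘ q`. If no point has order `n`, the points of `Q` fall into `n` levels with disjoint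
supports within each level, so at most `n` corrections act at any point and the norm is at most `1 +
2n`. The sum is continuous because only finitely many fibers carry an oscillation above a given
bound. -/

theorem isIsolatedIn_Ici_iff [TopologicalSpace X] {x : X} :
    IsIsolatedIn x (Ici x) ↔ 𝓝[>] x = ⊥ := by
  rw [← empty_mem_iff_bot, mem_nhdsWithin]
  constructor
  · rintro ⟨U, hU, h⟩
    have hx : x ∈ U ∩ Ici x := h ▸ rfl
    refine ⟨U, hU, hx.1, fun y hy => ?_⟩
    have : y ∈ U ∩ Ici x := ⟨hy.1, le_of_lt hy.2⟩
    rw [h] at this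
    exact (ne_of_gt hy.2 this).elim
  · rintro ⟨U, hU, hx, h⟩
    refine ⟨U, hU, subset_antisymm (fun y hy => ?_) ?_⟩
    · by_contra hne
      exact h ⟨hy.1, lt_of_le_of_ne hy.2 (Ne.symm hne)⟩
    · rintro y rfl
      exact ⟨hx, le_rfl⟩

theorem isIsolatedIn_Iic_iff [TopologicalSpace X] {x : X} :
    IsIsolatedIn x (Iic x) ↔ 𝓝[<] x = ⊥ :=
  isIsolatedIn_Ici_iff (X := Xᵒᵈ)

theorem IsInternal.neBot_right [TopologicalSpace X] {x : X} (h : IsInternal x) :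
    (𝓝[>] x).NeBot :=
  ⟨fun h' => h (Or.inl (isIsolatedIn_Ici_iff.2 h'))⟩

theorem IsInternal.neBot_left [TopologicalSpace X] {x : X} (h : IsInternal x) :
    (𝓝[<] x).NeBot :=
  ⟨fun h' => h (Or.inr (isIsolatedIn_Iic_iff.2 h'))⟩

theorem PointOrderGE.mem {A : Set X} {n : ℕ} {x : X} (h : PointOrderGE A n x) : x ∈ A := by
  cases n with
  | zero => exact h
  | succ n => exact h.1

theorem PointOrderGE.of_succ {A : Set X} {n : ℕ} {x : X} (h : PointOrderGE A (n + 1) x) :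
    PointOrderGE A n x := by
  induction n generalizing x with
  | zero => exact h.1
  | succ n ih =>
    obtain ⟨hx, h1, h2, h3, h4⟩ := h
    refine ⟨hx, h1.mono fun y hy => ⟨hy.1, hy.2.1, ih hy.2.2⟩,
      h2.mono fun y hy => ⟨hy.1, hy.2.1, ih hy.2.2⟩,
      ⟨fun y hy => hy.2.1.le, fun u hu => h3.2 fun y hy => hu ⟨hy.1, hy.2.1, ih hy.2.2⟩⟩,
      ⟨fun y hy => hy.2.1.le, fun u hu => h4.2 fun y hy => hu ⟨hy.1, hy.2.1, ih hy.2.2⟩⟩⟩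

theorem PointOrderGE.mono {A : Set X} {m n : ℕ} (hmn : m ≤ n) {x : X}
    (h : PointOrderGE A n x) : PointOrderGE A m x := by
  induction n, hmn using Nat.le_induction with
  | base => exact h
  | succ n _ ih => exact ih h.of_succ

/-- In `ℕ∞`, `m + 1 ≤ sSup s` gives `m < sSup s`, so some element exceeds `m`. Nonemptiness matters
only for `n = 0`. -/
theorem exists_mem_coe_le_of_le_sSup {s : Set ℕ∞} (hs : s.Nonempty) {n : ℕ}
    (h : (n : ℕ∞) ≤ sSup s) : ∃ k ∈ s, (n : ℕ∞) ≤ k := by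
  cases n with
  | zero => exact ⟨hs.some, hs.some_mem, by simp⟩
  | succ m =>
    have : (m : ℕ∞) < sSup s :=
      lt_of_lt_of_le (by exact_mod_cast Nat.lt_succ_self m) h
    obtain ⟨k, hk, hmk⟩ := lt_sSup_iff.1 this
    exact ⟨k, hk, by simpa using Order.add_one_le_of_lt hmk⟩

theorem coe_le_pointOrder_iff {A : Set X} {x : X} (hx : x ∈ A) {n : ℕ} :
    (n : ℕ∞) ≤ pointOrder A x ↔ PointOrderGE A n x := by
  constructor
  · intro h
    obtain ⟨k, ⟨m, hm, rfl⟩, hk⟩ := exists_mem_coe_le_of_le_sSup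
      (s := {k : ℕ∞ | ∃ n : ℕ, PointOrderGE A n x ∧ k = n}) ⟨0, 0, hx, rfl⟩ h
    exact hm.mono (by exact_mod_cast hk)
  · intro h
    exact le_sSup ⟨n, h, rfl⟩

/-- Reduces bounds on the internal order to the existence of a single point, the form in which both
estimates use them. -/
theorem natCast_le_internalOrder_iff {A : Set X} {n : ℕ} :
    (((n : ℤ)) : WithTop ℤ) ≤ internalOrder A ↔ ∃ x, PointOrderGE A n x := by
  unfold internalOrder
  split_ifs with hA
  · constructor
    · intro h
      have : (n : ℤ) ≤ -1 := by exact_mod_cast h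
      omega
    · rintro ⟨x, hx⟩
      exact absurd hx.mem (by simp [hA])
  · have key : (((n : ℤ)) : WithTop ℤ) ≤
        ENat.map (fun n : ℕ => (n : ℤ)) (sSup (pointOrder A '' A)) ↔
          (n : ℕ∞) ≤ sSup (pointOrder A '' A) := by
      cases sSup (pointOrder A '' A) with
      | top => simp
      | coe m =>
        rw [ENat.map_natCast]
        constructor
        · intro h
          have : (n : ℤ) ≤ m := by exact_mod_cast h
          exact_mod_cast this
        · intro h
          have : n ≤ m := by exact_mod_cast h
          exact_mod_cast this
    rw [key]
    constructor
    · intro h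
      obtain ⟨k, ⟨x, hx, rfl⟩, hk⟩ := exists_mem_coe_le_of_le_sSup
        ((nonempty_iff_ne_empty.2 hA).image _) h
      exact ⟨x, (coe_le_pointOrder_iff hx).1 hk⟩
    · rintro ⟨x, hx⟩
      exact ((coe_le_pointOrder_iff hx.mem).2 hx).trans (le_sSup ⟨x, hx.mem, rfl⟩)

theorem neg_one_le_internalOrder (A : Set X) : ((-1 : ℤ) : WithTop ℤ) ≤ internalOrder A := by
  by_cases hA : A = ∅
  · simp [internalOrder, hA]
  · obtain ⟨x, hx⟩ := nonempty_iff_ne_empty.2 hA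
    have := (natCast_le_internalOrder_iff (A := A) (n := 0)).2 ⟨x, hx⟩
    exact le_trans (by exact_mod_cast (by norm_num : (-1 : ℤ) ≤ 0)) this

end Order

/-! ### Fibers of a monotone surjection -/

section Fibers

variable {K L : Type*} [LinearOrder K] [TopologicalSpace K] [OrderTopology K]
  [LinearOrder L] [TopologicalSpace L] [OrderTopology L]

theorem exists_isLeast_fiber [CompactSpace K] (q : C(K, L)) (hsurj : Function.Surjective q)
    (x : L) : ∃ k, IsLeast (q ⁻¹' {x}) k :=
  ((isClosed_singleton.preimage q.continuous).isCompact).exists_isLeast (hsurj x)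

theorem exists_isGreatest_fiber [CompactSpace K] (q : C(K, L)) (hsurj : Function.Surjective q)
    (x : L) : ∃ k, IsGreatest (q ⁻¹' {x}) k :=
  ((isClosed_singleton.preimage q.continuous).isCompact).exists_isGreatest (hsurj x)


/-- Any section of `q` tends to the least point of the fiber from the left. -/
theorem tendsto_section_left {q : K → L} (hmono : Monotone q) {i : L → K}
    (hi : ∀ x, q (i x) = x) {x : L} {a : K} (ha : IsLeast (q ⁻¹' {x}) a) :
    Tendsto i (𝓝[<] x) (𝓝 a) := by
  have hax : q a = x := ha.1
  rw [tendsto_order]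
  constructor
  · intro k hk
    -- By minimality of `a`, a point below `a` is mapped strictly below `x`.
    have hqk : q k < x := lt_of_le_of_ne (hax ▸ hmono hk.le) fun h => (ha.2 h).not_gt hk
    filter_upwards [Ioo_mem_nhdsLT hqk] with z hz
    exact hmono.reflect_lt (by rw [hi]; exact hz.1)
  · intro k hk
    filter_upwards [self_mem_nhdsWithin] with z hz
    refine lt_trans (hmono.reflect_lt ?_) hk
    rw [hi, hax]
    exact hz

/-- Any section of `q` tends to the greatest point of the fiber from the right. -/
theorem tendsto_section_right {q : K → L} (hmono : Monotone q) {i : L → K}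
    (hi : ∀ x, q (i x) = x) {x : L} {b : K} (hb : IsGreatest (q ⁻¹' {x}) b) :
    Tendsto i (𝓝[>] x) (𝓝 b) :=
  tendsto_section_left (K := Kᵒᵈ) (L := Lᵒᵈ) (q := q) hmono.dual hi hb

theorem continuousAt_of_tendsto_left_right {X Y : Type*} [LinearOrder X] [TopologicalSpace X]
    [TopologicalSpace Y] {g : X → Y} {x : X} (hl : Tendsto g (𝓝[<] x) (𝓝 (g x)))
    (hr : Tendsto g (𝓝[>] x) (𝓝 (g x))) : ContinuousAt g x :=
  continuousAt_iff_continuous_left'_right'.2 ⟨hl, hr⟩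

/-- A section that takes an extreme value on each fiber, chosen on the side from which the point
is not isolated, is continuous outside of `internalNontrivialFibers q`. -/
theorem continuousAt_section {q : K → L} (hmono : Monotone q) {i a b : L → K}
    (hi : ∀ x, q (i x) = x) (ha : ∀ x, IsLeast (q ⁻¹' {x}) (a x))
    (hb : ∀ x, IsGreatest (q ⁻¹' {x}) (b x)) {x : L} (hx : x ∉ internalNontrivialFibers q)
    (hia : 𝓝[>] x = ⊥ → i x = a x) (hib : 𝓝[>] x ≠ ⊥ → i x = b x) : ContinuousAt i x := by
  have hl := tendsto_section_left hmono hi (ha x)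
  have hr := tendsto_section_right hmono hi (hb x)
  by_cases hbot : 𝓝[>] x = ⊥
  · refine continuousAt_of_tendsto_left_right (by rwa [hia hbot]) ?_
    rw [hbot]
    exact tendsto_bot
  · refine continuousAt_of_tendsto_left_right ?_ (by rwa [hib hbot])
    rw [hib hbot]
    -- The left limit is `a x`. Either `x` is isolated from the left and there is nothing to check,
    -- or the fiber is a singleton and `a x = b x`.
    by_cases hs : (q ⁻¹' {x}).Nontrivial
    · have hext : IsExternal x := by
        by_contra h
        exact hx ⟨h, hs⟩
      rcases hext with h | h
      · exact (hbot (isIsolatedIn_Ici_iff.1 h)).elim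
      · rw [isIsolatedIn_Iic_iff.1 h]
        exact tendsto_bot
    · rw [not_nontrivial_iff] at hs
      rwa [hs (hb x).1 (ha x).1]

/-- The oscillation of a continuous function on the fibers is arbitrarily small outside of a
finite set. -/
theorem finite_setOf_le_norm_sub {E : Type*} [NormedAddCommGroup E] [CompactSpace L] {q : K → L}
    (hmono : Monotone q) {a b : L → K} (ha : ∀ x, IsLeast (q ⁻¹' {x}) (a x))
    (hb : ∀ x, IsGreatest (q ⁻¹' {x}) (b x)) (f : C(K, E)) {ε : ℝ} (hε : 0 < ε) :
    {x | ε ≤ ‖f (b x) - f (a x)‖}.Finite := by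
  by_contra hinf
  obtain ⟨x, hx⟩ := Set.Infinite.exists_accPt_principal hinf
  have hqa : ∀ x, q (a x) = x := fun x => (ha x).1
  have hqb : ∀ x, q (b x) = x := fun x => (hb x).1
  -- Both `a` and `b` are sections, so from either side they have the same limit at the accumulation
  -- point, and the oscillation tends to `0`.
  have hlim : Tendsto (fun z => ‖f (b z) - f (a z)‖) (𝓝[≠] x) (𝓝 0) := by
    rw [← Iio_union_Ioi, nhdsWithin_union, tendsto_sup]
    constructor
    · have h1 := (f.continuous.tendsto (a x)).comp (tendsto_section_left hmono hqa (ha x))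
      have h2 := (f.continuous.tendsto (a x)).comp (tendsto_section_left hmono hqb (ha x))
      simpa using (h2.sub h1).norm
    · have h1 := (f.continuous.tendsto (b x)).comp (tendsto_section_right hmono hqa (hb x))
      have h2 := (f.continuous.tendsto (b x)).comp (tendsto_section_right hmono hqb (hb x))
      simpa using (h2.sub h1).norm
  rw [accPt_iff_frequently_nhdsNE] at hx
  exact hx ((hlim.eventually (gt_mem_nhds hε)).mono fun z hz => not_le.2 hz)

end Fibers

/-! ### Projections and averaging operators -/

section Averaging

variable {𝕜 : Type*} [RCLike 𝕜] {K L : Type*} [TopologicalSpace K] [TopologicalSpace L]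

theorem mem_pullback_iff {q : C(K, L)} {f : C(K, 𝕜)} :
    f ∈ pullback 𝕜 q ↔ ∃ g : C(L, 𝕜), g.comp q = f :=
  Iff.rfl

theorem comp_injective {q : C(K, L)} (hsurj : Function.Surjective q) :
    Function.Injective fun g : C(L, 𝕜) => g.comp q := by
  intro g g' h
  ext x
  obtain ⟨k, rfl⟩ := hsurj x
  exact DFunLike.congr_fun h k

variable [CompactSpace K]

theorem IsProjectionOnto.apply_comp {q : C(K, L)} {P : C(K, 𝕜) →L[𝕜] C(K, 𝕜)}
    (hP : IsProjectionOnto P (pullback 𝕜 q)) (g : C(L, 𝕜)) : P (g.comp q) = g.comp q := by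
  have : g.comp q ∈ LinearMap.range (P : C(K, 𝕜) →ₗ[𝕜] C(K, 𝕜)) := by
    rw [hP.2]
    exact ⟨g, rfl⟩
  obtain ⟨f, hf⟩ := this
  have hf' : P f = g.comp q := hf
  rw [← hf']
  exact DFunLike.congr_fun hP.1 f

theorem IsProjectionOnto.one_le_norm [Nonempty K] {q : C(K, L)}
    {P : C(K, 𝕜) →L[𝕜] C(K, 𝕜)} (hP : IsProjectionOnto P (pullback 𝕜 q)) : 1 ≤ ‖P‖ := by
  have h : P 1 = 1 := hP.apply_comp 1
  have := P.le_opNorm 1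
  rwa [h, norm_one, mul_one] at this

/-- A projection onto `pullback 𝕜 q` factors through an averaging operator. -/
theorem IsProjectionOnto.exists_averaging {q : C(K, L)} (hsurj : Function.Surjective q)
    {P : C(K, 𝕜) →L[𝕜] C(K, 𝕜)} (hP : IsProjectionOnto P (pullback 𝕜 q)) :
    ∃ T : C(K, 𝕜) →ₗ[𝕜] C(L, 𝕜), (∀ g : C(L, 𝕜), T (g.comp q) = g) ∧
      ∀ f : C(K, 𝕜), (∀ k, ‖f k‖ ≤ 1) → ∀ x, ‖T f x‖ ≤ ‖P‖ := by
  have hex : ∀ f, ∃ g : C(L, 𝕜), g.comp q = P f := fun f => by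
    rw [← mem_pullback_iff, ← hP.2]
    exact ⟨f, rfl⟩
  choose T hT using hex
  refine ⟨⟨⟨T, fun f g => comp_injective hsurj ?_⟩, fun c f => comp_injective hsurj ?_⟩,
    fun g => comp_injective hsurj ?_, fun f hf x => ?_⟩
  · ext k
    have h : ∀ f, T f (q k) = P f k := fun f => DFunLike.congr_fun (hT f) k
    simp [h]
  · ext k
    have h : ∀ f, T f (q k) = P f k := fun f => DFunLike.congr_fun (hT f) k
    simp [h]
  · exact (hT _).trans (hP.apply_comp g)
  · obtain ⟨k, rfl⟩ := hsurj x
    have h1 : T f (q k) = P f k := DFunLike.congr_fun (hT f) k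
    have h2 : ‖f‖ ≤ 1 := (ContinuousMap.norm_le _ zero_le_one).2 hf
    calc ‖T f (q k)‖ = ‖P f k‖ := by rw [h1]
      _ ≤ ‖P f‖ := (P f).norm_coe_le_norm k
      _ ≤ ‖P‖ * ‖f‖ := P.le_opNorm f
      _ ≤ ‖P‖ := mul_le_of_le_one_right (norm_nonneg _) h2

/-- An averaging operator induces a projection onto `pullback 𝕜 q`. -/
theorem exists_isProjectionOnto {q : C(K, L)} {T : C(K, 𝕜) →ₗ[𝕜] C(L, 𝕜)}
    (hT : ∀ g : C(L, 𝕜), T (g.comp q) = g) {c : ℝ} (hc : 0 ≤ c)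
    (hbound : ∀ f x, ‖T f x‖ ≤ c * ‖f‖) :
    ∃ P : C(K, 𝕜) →L[𝕜] C(K, 𝕜), IsProjectionOnto P (pullback 𝕜 q) ∧ ‖P‖ ≤ c := by
  let P₀ : C(K, 𝕜) →ₗ[𝕜] C(K, 𝕜) := (ContinuousMap.compRightAlgHom 𝕜 𝕜 q).toLinearMap ∘ₗ T
  have hP₀ : ∀ f, P₀ f = (T f).comp q := fun f => rfl
  have hb : ∀ f, ‖P₀ f‖ ≤ c * ‖f‖ := fun f =>
    (ContinuousMap.norm_le _ (mul_nonneg hc (norm_nonneg _))).2 fun k => hbound f (q k)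
  refine ⟨P₀.mkContinuous c hb, ⟨?_, ?_⟩, P₀.mkContinuous_norm_le hc hb⟩
  · ext1 f
    change P₀ (P₀ f) = P₀ f
    rw [hP₀ f, hP₀, hT]
  · ext f
    constructor
    · rintro ⟨g, rfl⟩
      exact ⟨T g, rfl⟩
    · rintro ⟨g, rfl⟩
      refine ⟨g.comp q, ?_⟩
      change P₀ (g.comp q) = g.comp q
      rw [hP₀, hT]

end Averaging

/-! ### The lower estimate -/

section LowerBound

variable {𝕜 : Type*} [RCLike 𝕜]

/-- A real continuous function, regarded as a scalar function. -/
def ofRealMap (𝕜 : Type*) [RCLike 𝕜] {X : Type*} [TopologicalSpace X] (g : C(X, ℝ)) : C(X, 𝕜) :=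
  ⟨fun x => (g x : 𝕜), RCLike.continuous_ofReal.comp g.continuous⟩

@[simp]
theorem ofRealMap_apply {X : Type*} [TopologicalSpace X] (g : C(X, ℝ)) (x : X) :
    ofRealMap 𝕜 g x = (g x : 𝕜) :=
  rfl

variable {K L : Type*} [TopologicalSpace K] [TopologicalSpace L]

/-- Where `φ` is nonzero the new value is `1 - 2φ ∈ [-1, 1]`, so the modification does not leave the
unit ball. -/
theorem norm_sub_two_smul_apply_le_one {f : C(K, 𝕜)} {φ : C(K, ℝ)} {k : K} (hf : ‖f k‖ ≤ 1)
    (hφ : φ k ∈ Icc (0 : ℝ) 1) (h : φ k ≠ 0 → f k = 1) :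
    ‖(f - (2 : 𝕜) • ofRealMap 𝕜 φ) k‖ ≤ 1 := by
  by_cases h0 : φ k = 0
  · simpa [h0] using hf
  · have : (f - (2 : 𝕜) • ofRealMap 𝕜 φ) k = ((1 - 2 * φ k : ℝ) : 𝕜) := by
      push_cast
      simp [h h0]
    rw [this, RCLike.norm_ofReal, abs_le]
    constructor <;> linarith [hφ.1, hφ.2]

theorem re_map_sub_two_smul (T : C(K, 𝕜) →ₗ[𝕜] C(L, 𝕜)) (f g : C(K, 𝕜)) (x : L) :
    RCLike.re (T (f - (2 : 𝕜) • g) x) = RCLike.re (T f x) - 2 * RCLike.re (T g x) := by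
  simp

/-- Subtracting twice a function supported near the fiber of `x` and vanishing on one side of it. -/
theorem eventually_sub_two_smul {q : C(K, L)} {T : C(K, 𝕜) →ₗ[𝕜] C(L, 𝕜)} {f : C(K, 𝕜)}
    {φ : C(K, ℝ)} {x : L} {U s : Set L} (hU : U ∈ 𝓝 x) (hUo : IsOpen U) (hs : IsOpen s)
    (hfU : ∀ k, q k ∈ U → f k = 1) (hφs : ∀ k, q k ∈ s → φ k = 0)
    (hre : 1 / 2 ≤ RCLike.re (T (ofRealMap 𝕜 φ) x)) {ε : ℝ} (hε : 0 < ε) :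
    ∀ᶠ z in 𝓝[s] x, (∀ᶠ y in 𝓝 z, ∀ k, q k = y → (f - (2 : 𝕜) • ofRealMap 𝕜 φ) k = 1) ∧
      RCLike.re (T (f - (2 : 𝕜) • ofRealMap 𝕜 φ) z) ≤ RCLike.re (T f x) - 1 + ε := by
  have hcont : ContinuousAt
      (fun z => RCLike.re (T (f - (2 : 𝕜) • ofRealMap 𝕜 φ) z)) x :=
    (RCLike.continuous_re.comp (ContinuousMap.continuous _)).continuousAt
  have hlt : RCLike.re (T (f - (2 : 𝕜) • ofRealMap 𝕜 φ) x) < RCLike.re (T f x) - 1 + ε := by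
    rw [re_map_sub_two_smul]
    linarith
  filter_upwards [self_mem_nhdsWithin, mem_nhdsWithin_of_mem_nhds hU,
    mem_nhdsWithin_of_mem_nhds (hcont.eventually (gt_mem_nhds hlt))] with z hzs hzU hz
  refine ⟨?_, le_of_lt hz⟩
  filter_upwards [hs.mem_nhds hzs, hUo.mem_nhds hzU] with y hys hyU k hk
  subst hk
  simp [hfU k hyU, hφs k hys]

/-- Near a point with constant value `1`, the deviation of an averaging operator adds up. -/
theorem two_sub_re_le [NormalSpace L] [T1Space L] {q : C(K, L)} {T : C(K, 𝕜) →ₗ[𝕜] C(L, 𝕜)}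
    (hT : ∀ g : C(L, 𝕜), T (g.comp q) = g) {c : ℝ}
    (hc : ∀ f : C(K, 𝕜), (∀ k, ‖f k‖ ≤ 1) → ∀ x, ‖T f x‖ ≤ c) {f : C(K, 𝕜)}
    (hf : ∀ k, ‖f k‖ ≤ 1) {x : L} (hfx : ∀ᶠ y in 𝓝 x, ∀ k, q k = y → f k = 1) :
    2 - RCLike.re (T f x) ≤ c := by
  obtain ⟨U, hUf, hUo, hxU⟩ := eventually_nhds_iff.1 hfx
  obtain ⟨g, hg0, hg1, hg⟩ := exists_continuous_zero_one_of_isClosed hUo.isClosed_compl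
    (isClosed_singleton (x := x)) (by simpa using hxU)
  -- The bump comes from `L`, so `T` reproduces it and the value at `x` drops by exactly `2`.
  have key := hc (f - (2 : 𝕜) • ofRealMap 𝕜 (g.comp q))
    (fun k => norm_sub_two_smul_apply_le_one (hf k) (hg _) fun h => by
      by_contra hne
      exact h (hg0 fun hk => hne (hUf _ hk k rfl))) x
  have hre := (RCLike.abs_re_le_norm _).trans key
  have hTg : T (ofRealMap 𝕜 (g.comp q)) = ofRealMap 𝕜 g := hT (ofRealMap 𝕜 g)
  rw [re_map_sub_two_smul, hTg] at hre
  have h1 : g x = 1 := hg1 rfl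
  simp only [ofRealMap_apply, h1, map_one, RCLike.one_re, mul_one] at hre
  linarith [neg_abs_le (RCLike.re (T f x) - 2)]

end LowerBound

/-! ### Iterating the deviation along points of decreasing order -/

section LowerBoundLine

variable {𝕜 : Type*} [RCLike 𝕜] {K L : Type*}
  [LinearOrder K] [TopologicalSpace K] [OrderTopology K]
  [LinearOrder L] [TopologicalSpace L] [OrderTopology L]

/-- At a point with nontrivial fiber the deviation of an averaging operator can be increased by
almost `1` on one side of the point. -/
theorem exists_deviation_step {q : C(K, L)} (hmono : Monotone q)
    {T : C(K, 𝕜) →ₗ[𝕜] C(L, 𝕜)} (hT : ∀ g : C(L, 𝕜), T (g.comp q) = g) {f : C(K, 𝕜)}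
    (hf : ∀ k, ‖f k‖ ≤ 1) {x : L} (hx : (q ⁻¹' {x}).Nontrivial)
    (hfx : ∀ᶠ y in 𝓝 x, ∀ k, q k = y → f k = 1) {ε : ℝ} (hε : 0 < ε) :
    ∃ f' : C(K, 𝕜), (∀ k, ‖f' k‖ ≤ 1) ∧ ∃ s, (s = Iio x ∨ s = Ioi x) ∧
      ∀ᶠ z in 𝓝[s] x, (∀ᶠ y in 𝓝 z, ∀ k, q k = y → f' k = 1) ∧
        RCLike.re (T f' z) ≤ RCLike.re (T f x) - 1 + ε := by
  obtain ⟨U, hUf, hUo, hxU⟩ := eventually_nhds_iff.1 hfx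
  obtain ⟨g, hg0, hg1, hg⟩ := exists_continuous_zero_one_of_isClosed hUo.isClosed_compl
    (isClosed_singleton (x := x)) (by simpa using hxU)
  obtain ⟨a, ha, b, hb, hab⟩ := hx.exists_lt
  -- `ψ` vanishes on the fibers to the left of `x`, and `1 - ψ` on those to the right.
  obtain ⟨ψ, hψ0, hψ1, hψ⟩ := exists_continuous_zero_one_of_isClosed (isClosed_Iic (a := a))
    (isClosed_Ici (a := b)) (Set.disjoint_left.2 fun k h1 h2 =>
      (lt_of_lt_of_le hab (le_trans h2 h1)).false)
  have hUf' : ∀ k, q k ∈ U → f k = 1 := fun k hk => hUf _ hk k rfl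
  have hgU : ∀ k, g (q k) ≠ 0 → f k = 1 := fun k h => by
    by_contra hne
    exact h (hg0 fun hk => hne (hUf' k hk))
  -- The two halves add up to `g ∘ q`, whose image under `T` is `1` at `x`; hence one of them has
  -- real part at least `1/2` there.
  have hsum : RCLike.re (T (ofRealMap 𝕜 (ψ * g.comp q)) x) +
      RCLike.re (T (ofRealMap 𝕜 ((1 - ψ) * g.comp q)) x) = 1 := by
    have hadd : ofRealMap 𝕜 (ψ * g.comp q) + ofRealMap 𝕜 ((1 - ψ) * g.comp q) =
        (ofRealMap 𝕜 g).comp q := by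
      ext k
      simp only [ContinuousMap.add_apply, ofRealMap_apply, ContinuousMap.mul_apply,
        ContinuousMap.comp_apply, ContinuousMap.sub_apply, ContinuousMap.one_apply]
      push_cast
      ring
    have h1 : g x = 1 := hg1 rfl
    rw [← map_add, ← ContinuousMap.add_apply, ← map_add, hadd, hT]
    simp [h1]
  rcases le_or_gt (1 / 2) (RCLike.re (T (ofRealMap 𝕜 (ψ * g.comp q)) x)) with h | h
  · refine ⟨f - (2 : 𝕜) • ofRealMap 𝕜 (ψ * g.comp q), fun k => ?_, Iio x, Or.inl rfl,
      eventually_sub_two_smul (hUo.mem_nhds hxU) hUo isOpen_Iio hUf' (fun k hk => ?_) h hε⟩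
    · exact norm_sub_two_smul_apply_le_one (hf k)
        ⟨mul_nonneg (hψ k).1 (hg _).1, mul_le_one₀ (hψ k).2 (hg _).1 (hg _).2⟩
        fun h => hgU k (right_ne_zero_of_mul h)
    · have hka : k ≤ a := (hmono.reflect_lt (lt_of_lt_of_eq hk (Eq.symm ha))).le
      have : ψ k = 0 := hψ0 hka
      simp [this]
  · refine ⟨f - (2 : 𝕜) • ofRealMap 𝕜 ((1 - ψ) * g.comp q), fun k => ?_, Ioi x, Or.inr rfl,
      eventually_sub_two_smul (hUo.mem_nhds hxU) hUo isOpen_Ioi hUf' (fun k hk => ?_)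
        (by linarith) hε⟩
    · refine norm_sub_two_smul_apply_le_one (hf k)
        ⟨mul_nonneg (sub_nonneg.2 (hψ k).2) (hg _).1,
          mul_le_one₀ (sub_le_self _ (hψ k).1) (hg _).1 (hg _).2⟩
        fun h => hgU k (right_ne_zero_of_mul h)
    · have hkb : b ≤ k := (hmono.reflect_lt (lt_of_eq_of_lt hb hk)).le
      have : ψ k = 1 := hψ1 hkb
      simp [this]

theorem PointOrderGE.frequently_left {A : Set L} {n : ℕ} {x : L}
    (h : PointOrderGE A (n + 1) x) : ∃ᶠ z in 𝓝[<] x, PointOrderGE A n z :=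
  frequently_nhdsWithin_iff.2
    ((h.2.2.2.1.frequently_nhds_mem h.2.1).mono fun _ hz => ⟨hz.2.2, hz.2.1⟩)

theorem PointOrderGE.frequently_right {A : Set L} {n : ℕ} {x : L}
    (h : PointOrderGE A (n + 1) x) : ∃ᶠ z in 𝓝[>] x, PointOrderGE A n z :=
  frequently_nhdsWithin_iff.2
    ((h.2.2.2.2.frequently_nhds_mem h.2.2.1).mono fun _ hz => ⟨hz.2.2, hz.2.1⟩)

/-- Induction on the order: each step gains `1 - ε` and moves to a nearby point of order one less.
The side is dictated by `T`, which is why the order demands accumulation from both sides. At order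
`0`, internality alone still allows one step, followed by the gain of `2` from `two_sub_re_le`. -/
theorem add_three_sub_re_le {q : C(K, L)} (hmono : Monotone q) {T : C(K, 𝕜) →ₗ[𝕜] C(L, 𝕜)}
    (hT : ∀ g : C(L, 𝕜), T (g.comp q) = g) {c : ℝ}
    (hc : ∀ f : C(K, 𝕜), (∀ k, ‖f k‖ ≤ 1) → ∀ x, ‖T f x‖ ≤ c) (n : ℕ) {f : C(K, 𝕜)}
    (hf : ∀ k, ‖f k‖ ≤ 1) {x : L} (hx : PointOrderGE (internalNontrivialFibers q) n x)
    (hfx : ∀ᶠ y in 𝓝 x, ∀ k, q k = y → f k = 1) :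
    n + 3 - RCLike.re (T f x) ≤ c := by
  induction n generalizing f x with
  | zero =>
    refine le_of_forall_pos_le_add fun ε hε => ?_
    obtain ⟨f', hf', s, hs, h⟩ := exists_deviation_step hmono hT hf hx.mem.2 hfx hε
    have hne : (𝓝[s] x).NeBot := by
      rcases hs with rfl | rfl
      · exact hx.mem.1.neBot_left
      · exact hx.mem.1.neBot_right
    obtain ⟨z, hz1, hz2⟩ := h.exists
    have := two_sub_re_le hT hc hf' hz1
    push_cast
    linarith
  | succ n ih =>
    refine le_of_forall_pos_le_add fun ε hε => ?_
    obtain ⟨f', hf', s, hs, h⟩ := exists_deviation_step hmono hT hf hx.mem.2 hfx hε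
    have hfr : ∃ᶠ z in 𝓝[s] x, PointOrderGE (internalNontrivialFibers q) n z := by
      rcases hs with rfl | rfl
      · exact hx.frequently_left
      · exact hx.frequently_right
    obtain ⟨z, hzn, hz1, hz2⟩ := (hfr.and_eventually h).exists
    have := ih hf' hzn hz1
    push_cast
    linarith

/-- The lower estimate for the norm of a projection. -/
theorem IsProjectionOnto.add_two_le_norm [CompactSpace K] {q : C(K, L)} (hmono : Monotone q)
    (hsurj : Function.Surjective q) {P : C(K, 𝕜) →L[𝕜] C(K, 𝕜)}
    (hP : IsProjectionOnto P (pullback 𝕜 q)) {n : ℕ} {x : L}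
    (hx : PointOrderGE (internalNontrivialFibers q) n x) : (n : ℝ) + 2 ≤ ‖P‖ := by
  obtain ⟨T, hT, hc⟩ := hP.exists_averaging hsurj
  have h := add_three_sub_re_le hmono hT hc n (f := 1) (by simp) hx
    (Eventually.of_forall fun _ _ _ => rfl)
  have h1 : T 1 = 1 := hT 1
  rw [h1] at h
  simp only [ContinuousMap.one_apply, RCLike.one_re] at h
  linarith

end LowerBoundLine

/-! ### The upper estimate -/

section UpperBound

variable {L : Type*} [LinearOrder L]

/-- If no point of `B ⊆ S` is a two-sided limit of `S`, then the points of `B` have pairwise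
disjoint one-sided neighborhoods. -/
theorem exists_pairwiseDisjoint_intervals {S B : Set L} (hBS : B ⊆ S)
    (hB : ∀ x ∈ B, ∀ c, x < c → (Ioo x c).Nonempty)
    (hgap : ∀ x ∈ B, (∃ c, x < c ∧ Disjoint (Ioo x c) S) ∨ ∃ c, c < x ∧ Disjoint (Ioo c x) S) :
    ∃ c : L → L, (∀ x ∈ B, c x ≠ x) ∧
      B.PairwiseDisjoint fun x => Ioo x (c x) ∪ Ioo (c x) x := by
  have hR : ∀ x, ∃ e, (x ∈ B ∧ ∃ c, x < c ∧ Disjoint (Ioo x c) S) →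
      x < e ∧ e ∉ S ∧ Disjoint (Ioo x e) S := by
    intro x
    by_cases h : x ∈ B ∧ ∃ c, x < c ∧ Disjoint (Ioo x c) S
    · obtain ⟨hx, c, hc, hd⟩ := h
      obtain ⟨e, he⟩ := hB x hx c hc
      exact ⟨e, fun _ => ⟨he.1, Set.disjoint_left.1 hd he,
        hd.mono_left (Ioo_subset_Ioo_right he.2.le)⟩⟩
    · exact ⟨x, fun h' => (h h').elim⟩
  choose e he using hR
  set R : Set L := {x | x ∈ B ∧ ∃ c, x < c ∧ Disjoint (Ioo x c) S} with hRdef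
  have hRe : ∀ x ∈ R, x < e x ∧ e x ∉ S ∧ Disjoint (Ioo x (e x)) S := fun x hx => he x hx
  have hLc : ∀ y, ∃ c, (y ∈ B ∧ y ∉ R) →
      c < y ∧ Disjoint (Ioo c y) S ∧ ∀ x ∈ R, Disjoint (Ioo x (e x)) (Ioo c y) := by
    intro y
    by_cases h : y ∈ B ∧ y ∉ R
    · obtain ⟨hy, hyR⟩ := h
      obtain ⟨c, hc, hd⟩ := (hgap y hy).resolve_left fun h' => hyR ⟨hy, h'⟩
      -- At most one right interval can meet the left gap `(c, y)`: another one would have to start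
      -- at or before `e x`, hence before `x`, and would contain `x ∈ S`. Cutting the gap at `e x`
      -- therefore separates `y` from all right intervals.
      by_cases hp : ∃ x ∈ R, ¬ Disjoint (Ioo x (e x)) (Ioo c y)
      · obtain ⟨x, hx, hxy⟩ := hp
        obtain ⟨z, hz1, hz2⟩ := Set.not_disjoint_iff.1 hxy
        obtain ⟨hxe, heS, hdx⟩ := hRe x hx
        have hey : e x < y := by
          refine lt_of_le_of_ne (not_lt.1 fun h => ?_) fun h => heS (h ▸ hBS hy)
          exact Set.disjoint_left.1 hdx ⟨hz1.1.trans hz2.2, h⟩ (hBS hy)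
        have hcx : c < e x := hz2.1.trans hz1.2
        refine ⟨e x, fun _ => ⟨hey, hd.mono_left (Ioo_subset_Ioo_left hcx.le), fun x' hx' => ?_⟩⟩
        refine Set.disjoint_left.2 fun w hw1 hw2 => ?_
        have h1 : x' ≤ e x := not_lt.1 fun h =>
          Set.disjoint_left.1 hd ⟨hcx.trans h, hw1.1.trans hw2.2⟩ (hBS hx'.1)
        have h2 : x' ≤ x := not_lt.1 fun h =>
          Set.disjoint_left.1 hdx
            ⟨h, lt_of_le_of_ne h1 fun h' => heS (h' ▸ hBS hx'.1)⟩ (hBS hx'.1)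
        rcases h2.eq_or_lt with rfl | h2
        · exact (hw2.1.trans hw1.2).false
        · exact Set.disjoint_left.1 (hRe x' hx').2.2
            ⟨h2, hxe.trans (hw2.1.trans hw1.2)⟩ (hBS hx.1)
      · push Not at hp
        exact ⟨c, fun _ => ⟨hc, hd, hp⟩⟩
    · exact ⟨y, fun h' => (h h').elim⟩
  choose c hc using hLc
  classical
  refine ⟨fun x => if x ∈ R then e x else c x, fun x hx => ?_, ?_⟩
  · by_cases hxR : x ∈ R
    · simpa [hxR] using (hRe x hxR).1.ne'
    · simpa [hxR] using (hc x ⟨hx, hxR⟩).1.ne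
  · have hIR : ∀ x ∈ R, Ioo x (if x ∈ R then e x else c x) ∪
        Ioo (if x ∈ R then e x else c x) x = Ioo x (e x) := fun x hx => by
      rw [if_pos hx, Ioo_eq_empty (hRe x hx).1.not_gt, union_empty]
    have hIL : ∀ x ∈ B, x ∉ R → Ioo x (if x ∈ R then e x else c x) ∪
        Ioo (if x ∈ R then e x else c x) x = Ioo (c x) x := fun x hxB hx => by
      rw [if_neg hx, Ioo_eq_empty (hc x ⟨hxB, hx⟩).1.not_gt, empty_union]
    have main : ∀ x ∈ B, ∀ y ∈ B, x < y →
        Disjoint (Ioo x (if x ∈ R then e x else c x) ∪ Ioo (if x ∈ R then e x else c x) x)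
          (Ioo y (if y ∈ R then e y else c y) ∪ Ioo (if y ∈ R then e y else c y) y) := by
      intro x hx y hy hxy
      refine Set.disjoint_left.2 fun z => ?_
      by_cases hxR : x ∈ R <;> by_cases hyR : y ∈ R
      · rw [hIR x hxR, hIR y hyR]
        exact fun h1 h2 =>
          Set.disjoint_left.1 (hRe x hxR).2.2 ⟨hxy, h2.1.trans h1.2⟩ (hBS hy)
      · rw [hIR x hxR, hIL y hy hyR]
        exact fun h1 h2 => Set.disjoint_left.1 ((hc y ⟨hy, hyR⟩).2.2 x hxR) h1 h2
      · rw [hIL x hx hxR, hIR y hyR]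
        exact fun h1 h2 => (hxy.trans (h2.1.trans h1.2)).false
      · rw [hIL x hx hxR, hIL y hy hyR]
        exact fun h1 h2 =>
          Set.disjoint_left.1 (hc y ⟨hy, hyR⟩).2.1 ⟨h2.1.trans h1.2, hxy⟩ (hBS hx)
    intro x hx y hy hxy
    rcases lt_or_gt_of_ne hxy with h | h
    · exact main x hx y hy h
    · exact (main y hy x hx h).symm

/-- If points of order at least `n` accumulated at `x` from both sides, `x` would have order at
least `n + 1`. Internality supplies points on both sides of `x`, which makes the two sets nonempty.
-/
theorem exists_gap_of_not_pointOrderGE [TopologicalSpace L] [OrderTopology L] {A : Set L} {n : ℕ}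
    {x : L} (hx : x ∈ A) (hint : IsInternal x) (h : ¬ PointOrderGE A (n + 1) x) :
    (∃ c, x < c ∧ Disjoint (Ioo x c) {y | PointOrderGE A n y}) ∨
      ∃ c, c < x ∧ Disjoint (Ioo c x) {y | PointOrderGE A n y} := by
  by_contra! hcon
  obtain ⟨hr, hl⟩ := hcon
  have hr' : ∀ c, x < c → ∃ y, y < c ∧ y ∈ A ∧ x < y ∧ PointOrderGE A n y := fun c hc => by
    obtain ⟨y, hy, hyA⟩ := Set.not_disjoint_iff.1 (hr c hc)
    exact ⟨y, hy.2, PointOrderGE.mem hyA, hy.1, hyA⟩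
  have hl' : ∀ c, c < x → ∃ y, c < y ∧ y ∈ A ∧ y < x ∧ PointOrderGE A n y := fun c hc => by
    obtain ⟨y, hy, hyA⟩ := Set.not_disjoint_iff.1 (hl c hc)
    exact ⟨y, hy.1, PointOrderGE.mem hyA, hy.2, hyA⟩
  have := hint.neBot_left
  have := hint.neBot_right
  obtain ⟨c₁, hc₁⟩ := Filter.nonempty_of_mem (self_mem_nhdsWithin (s := Iio x) (a := x))
  obtain ⟨c₂, hc₂⟩ := Filter.nonempty_of_mem (self_mem_nhdsWithin (s := Ioi x) (a := x))
  obtain ⟨y₁, -, hy₁⟩ := hl' c₁ hc₁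
  obtain ⟨y₂, -, hy₂⟩ := hr' c₂ hc₂
  refine h ⟨hx, ⟨y₁, hy₁⟩, ⟨y₂, hy₂⟩, ⟨fun y hy => hy.2.1.le, fun u hu => ?_⟩,
    ⟨fun y hy => hy.2.1.le, fun u hu => ?_⟩⟩
  · by_contra! hux
    obtain ⟨y, huy, hy⟩ := hl' u hux
    exact (hu hy).not_gt huy
  · by_contra! hux
    obtain ⟨y, huy, hy⟩ := hr' u hux
    exact (hu hy).not_gt huy

/-- A function supported in the one-sided neighborhood of `x` with end point `c`, whose only
discontinuity is a jump by `1` at `x`. -/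
theorem exists_jump_function [TopologicalSpace L] [OrderTopology L] [CompactSpace L] {x c : L}
    (hxc : c ≠ x) : ∃ h : L → ℝ, (∀ z, h z ≠ 0 → z ∈ Ioo x c ∪ Ioo c x) ∧ (∀ z, |h z| ≤ 1) ∧
      (∀ y, y ≠ x → ContinuousAt h y) ∧
      (x < c → Tendsto h (𝓝[<] x) (𝓝 0) ∧ Tendsto h (𝓝[>] x) (𝓝 1)) ∧
      (c < x → Tendsto h (𝓝[<] x) (𝓝 (-1)) ∧ Tendsto h (𝓝[>] x) (𝓝 0)) := by
  classical
  rcases lt_or_gt_of_ne hxc with hlt | hlt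
  · obtain ⟨u, hu0, hu1, hu⟩ := exists_continuous_zero_one_of_isClosed (isClosed_Iic (a := c))
      (isClosed_singleton (x := x)) (by simpa using hlt)
    have hl : ∀ z, z < x → (fun z => if z < x then - u z else 0) =ᶠ[𝓝 z] fun z => - u z :=
      fun z hz => by
        filter_upwards [Iio_mem_nhds hz] with w hw
        exact if_pos hw
    have hr : ∀ᶠ z in 𝓝[>] x, (if z < x then - u z else 0) = 0 := by
      filter_upwards [self_mem_nhdsWithin] with w hw
      exact if_neg (not_lt.2 (le_of_lt hw))
    have hl' : ∀ᶠ z in 𝓝[<] x, - u z = (if z < x then - u z else 0) := by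
      filter_upwards [self_mem_nhdsWithin] with w hw
      exact (if_pos hw).symm
    refine ⟨fun z => if z < x then - u z else 0, fun z hz => Or.inr ?_, fun z => ?_,
      fun y hy => ?_, fun h => (h.not_gt hlt).elim, fun _ => ⟨?_, ?_⟩⟩
    · by_cases hzx : z < x
      · refine ⟨not_le.1 fun h => hz ?_, hzx⟩
        have : u z = 0 := hu0 h
        simp [this]
      · simp [hzx] at hz
    · by_cases hzx : z < x
      · simpa [hzx, abs_of_nonneg (hu z).1] using (hu z).2
      · simp [hzx]
    · rcases lt_or_gt_of_ne hy with h | h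
      · exact u.continuous.neg.continuousAt.congr (hl y h).symm
      · refine (continuousAt_const (y := (0 : ℝ))).congr ?_
        filter_upwards [Ioi_mem_nhds h] with w hw
        exact (if_neg (not_lt.2 (le_of_lt hw))).symm
    · have : Tendsto (fun z => - u z) (𝓝[<] x) (𝓝 (- u x)) :=
        (u.continuous.neg.tendsto x).mono_left nhdsWithin_le_nhds
      rw [show u x = 1 from hu1 rfl] at this
      exact this.congr' hl'
    · exact tendsto_const_nhds.congr' (hr.mono fun _ h => h.symm)
  · obtain ⟨u, hu0, hu1, hu⟩ := exists_continuous_zero_one_of_isClosed (isClosed_Ici (a := c))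
      (isClosed_singleton (x := x)) (by simpa using hlt)
    refine ⟨fun z => if x < z then u z else 0, fun z hz => Or.inl ?_, fun z => ?_,
      fun y hy => ?_, fun _ => ⟨?_, ?_⟩, fun h => (h.not_gt hlt).elim⟩
    · by_cases hzx : x < z
      · exact ⟨hzx, not_le.1 fun h => hz (by simpa [hzx] using hu0 h)⟩
      · simp [hzx] at hz
    · by_cases hzx : x < z
      · simpa [hzx, abs_of_nonneg (hu z).1] using (hu z).2
      · simp [hzx]
    · rcases lt_or_gt_of_ne hy with h | h
      · refine (continuousAt_const (y := (0 : ℝ))).congr ?_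
        filter_upwards [Iio_mem_nhds h] with w hw
        exact (if_neg (not_lt.2 (le_of_lt hw))).symm
      · refine u.continuous.continuousAt.congr ?_
        filter_upwards [Ioi_mem_nhds h] with w hw
        exact (if_pos hw).symm
    · refine tendsto_const_nhds.congr' ?_
      filter_upwards [self_mem_nhdsWithin] with w hw
      exact (if_neg (not_lt.2 (le_of_lt hw))).symm
    · have : Tendsto u (𝓝[>] x) (𝓝 (u x)) :=
        (u.continuous.tendsto x).mono_left nhdsWithin_le_nhds
      rw [show u x = 1 from hu1 rfl] at this
      refine this.congr' ?_
      filter_upwards [self_mem_nhdsWithin] with w hw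
      exact (if_pos hw).symm

end UpperBound

/-! ### Levels of intervals, the corrected section and the projection -/

section Operator

variable {K L : Type*}
  [LinearOrder K] [TopologicalSpace K] [OrderTopology K]
  [LinearOrder L] [TopologicalSpace L] [OrderTopology L]

/-- If every point of `A` has order less than `n`, the points of `A` have one-sided neighborhoods
such that each point of the line lies in at most `n` of them. -/
theorem exists_intervals_of_order_lt {A : Set L} (hA : ∀ x ∈ A, IsInternal x) {n : ℕ}
    (hn : ∀ x, ¬ PointOrderGE A n x) :
    ∃ c : L → L, (∀ x ∈ A, c x ≠ x) ∧ ∃ lev : L → ℕ, (∀ x ∈ A, lev x < n) ∧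
      ∀ x ∈ A, ∀ y ∈ A, lev x = lev y → x ≠ y →
        Disjoint (Ioo x (c x) ∪ Ioo (c x) x) (Ioo y (c y) ∪ Ioo (c y) y) := by
  classical
  -- The level is the exact order of `x`, one less than the first index at which `PointOrderGE`
  -- fails.
  have hlev : ∀ x, ∃ k, x ∈ A → k < n ∧ PointOrderGE A k x ∧ ¬ PointOrderGE A (k + 1) x := by
    intro x
    by_cases hx : x ∈ A
    · have hex : ∃ k, ¬ PointOrderGE A k x := ⟨n, hn x⟩
      have h0 : Nat.find hex ≠ 0 := fun h => by
        have := Nat.find_spec hex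
        rw [h] at this
        exact this hx
      obtain ⟨k, hk⟩ := Nat.exists_eq_succ_of_ne_zero h0
      refine ⟨k, fun _ => ⟨?_, ?_, ?_⟩⟩
      · have := Nat.find_min' hex (hn x)
        omega
      · exact not_not.1 (Nat.find_min hex (m := k) (by omega))
      · have := Nat.find_spec hex
        rwa [hk] at this
    · exact ⟨0, fun h => (hx h).elim⟩
  choose lev hlev using hlev
  have hc : ∀ k, ∃ c : L → L, (∀ x ∈ {x | x ∈ A ∧ lev x = k}, c x ≠ x) ∧
      {x | x ∈ A ∧ lev x = k}.PairwiseDisjoint fun x => Ioo x (c x) ∪ Ioo (c x) x := by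
    intro k
    refine exists_pairwiseDisjoint_intervals (S := {y | PointOrderGE A k y}) ?_ ?_ ?_
    · rintro x ⟨hx, rfl⟩
      exact (hlev x hx).2.1
    · rintro x ⟨hx, -⟩ c hxc
      have := (hA x hx).neBot_right
      exact Filter.nonempty_of_mem (Ioo_mem_nhdsGT hxc)
    · rintro x ⟨hx, rfl⟩
      exact exists_gap_of_not_pointOrderGE hx (hA x hx) (hlev x hx).2.2
  choose c hcne hcd using hc
  refine ⟨fun x => c (lev x) x, fun x hx => hcne _ x ⟨hx, rfl⟩, lev,
    fun x hx => (hlev x hx).1, fun x hx y hy hxy hne => ?_⟩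
  have := hcd (lev x) ⟨hx, rfl⟩ ⟨hy, hxy.symm⟩ hne
  simpa only [← hxy] using this

/-- A section of `q` corrected by jump functions yields continuous functions. -/
theorem continuous_corrected_section [CompactSpace L] {𝕜 : Type*} [RCLike 𝕜] {q : K → L}
    (hmono : Monotone q) {a b i : L → K} (ha : ∀ x, IsLeast (q ⁻¹' {x}) (a x))
    (hb : ∀ x, IsGreatest (q ⁻¹' {x}) (b x)) (hi : ∀ x, q (i x) = x) {A : Set L}
    (hiA : ∀ x ∉ A, ContinuousAt i x) {h : L → L → ℝ} (hbound : ∀ y z, |h y z| ≤ 1)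
    (hcont : ∀ y z, z ≠ y → ContinuousAt (h y) z) (hzero : ∀ y, h y y = 0)
    (hjump : ∀ x ∈ A, (i x = a x ∧ Tendsto (h x) (𝓝[<] x) (𝓝 0) ∧
        Tendsto (h x) (𝓝[>] x) (𝓝 1)) ∨
      (i x = b x ∧ Tendsto (h x) (𝓝[<] x) (𝓝 (-1)) ∧ Tendsto (h x) (𝓝[>] x) (𝓝 0)))
    {n : ℕ} {F : L → Finset L} (hF : ∀ z y, y ∈ F z ↔ y ∈ A ∧ h y z ≠ 0)
    (hcard : ∀ z, (F z).card ≤ n) (f : C(K, 𝕜)) :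
    Continuous fun z => f (i z) - ∑ y ∈ F z, (h y z : 𝕜) * (f (b y) - f (a y)) := by
  classical
  rw [continuous_iff_continuousAt]
  intro x
  refine continuousAt_of_locally_uniform_approx_of_continuousAt fun u hu => ?_
  obtain ⟨ε, hε, hεu⟩ := Metric.mem_uniformity_dist.1 hu
  -- At most `n` discarded terms, each at most `ε / (n + 1)`, sum to strictly less than `ε`; this
  -- also covers `n = 0`.
  have hδ : 0 < ε / (n + 1) := by positivity
  have hfin := finite_setOf_le_norm_sub hmono ha hb f hδ
  -- A finite set of corrections that serves all `z` at once. The point `x` is added even if its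
  -- oscillation is small, so that its jump is cancelled exactly.
  let E : Finset L := (insert x hfin.toFinset).filter (· ∈ A)
  have hE : ∀ y, y ∈ E ↔ (y = x ∨ ε / (n + 1) ≤ ‖f (b y) - f (a y)‖) ∧ y ∈ A := fun y => by
    simp [E]
  refine ⟨univ, univ_mem,
    fun z => f (i z) - ∑ y ∈ E, (h y z : 𝕜) * (f (b y) - f (a y)), ?_, fun z _ => hεu ?_⟩
  · have hhc : ∀ y, y ≠ x →
        ContinuousAt (fun z => (h y z : 𝕜) * (f (b y) - f (a y))) x := fun y hy =>
      (RCLike.continuous_ofReal.continuousAt.comp (hcont y x hy.symm)).mul continuousAt_const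
    by_cases hx : x ∈ A
    · have hxE : x ∈ E := (hE x).2 ⟨Or.inl rfl, hx⟩
      -- Among the terms of `E`, only that of `x` can be discontinuous at `x`; its jump cancels that
      -- of `f ∘ i`.
      have hsplit : (fun z => f (i z) - ∑ y ∈ E, (h y z : 𝕜) * (f (b y) - f (a y))) =
          fun z => (f (i z) - (h x z : 𝕜) * (f (b x) - f (a x))) -
            ∑ y ∈ E.erase x, (h y z : 𝕜) * (f (b y) - f (a y)) := by
        funext z
        rw [← Finset.add_sum_erase E _ hxE]
        ring
      rw [hsplit]
      refine ContinuousAt.sub ?_ (tendsto_finsetSum _ fun y hy =>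
        hhc y (Finset.ne_of_mem_erase hy))
      have hl := (f.continuous.tendsto _).comp (tendsto_section_left hmono hi (ha x))
      have hr := (f.continuous.tendsto _).comp (tendsto_section_right hmono hi (hb x))
      have hmul : ∀ {l : Filter L} {r : ℝ}, Tendsto (h x) l (𝓝 r) →
          Tendsto (fun z => (h x z : 𝕜) * (f (b x) - f (a x))) l
            (𝓝 ((r : 𝕜) * (f (b x) - f (a x)))) := fun hr =>
        ((RCLike.continuous_ofReal.tendsto _).comp hr).mul_const _
      rcases hjump x hx with ⟨hix, h1, h2⟩ | ⟨hix, h1, h2⟩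
      · refine continuousAt_of_tendsto_left_right ?_ ?_
        · simpa [hix, hzero] using hl.sub (hmul h1)
        · simpa [hix, hzero] using hr.sub (hmul h2)
      · refine continuousAt_of_tendsto_left_right ?_ ?_
        · simpa [hix, hzero] using hl.sub (hmul h1)
        · simpa [hix, hzero] using hr.sub (hmul h2)
    · refine ContinuousAt.sub (f.continuous.continuousAt.comp (hiA x hx))
        (tendsto_finsetSum _ fun y hy => hhc y ?_)
      rintro rfl
      exact hx ((hE y).1 hy).2
  · have h1 : ∑ y ∈ E, (h y z : 𝕜) * (f (b y) - f (a y)) =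
        ∑ y ∈ F z ∩ E, (h y z : 𝕜) * (f (b y) - f (a y)) := by
      refine (Finset.sum_subset Finset.inter_subset_right fun y hyE hy => ?_).symm
      have : h y z = 0 := by
        by_contra hne
        exact hy (Finset.mem_inter.2 ⟨(hF z y).2 ⟨((hE y).1 hyE).2, hne⟩, hyE⟩)
      simp [this]
    have h2 : ∑ y ∈ F z, (h y z : 𝕜) * (f (b y) - f (a y)) =
        ∑ y ∈ F z ∩ E, (h y z : 𝕜) * (f (b y) - f (a y)) +
          ∑ y ∈ F z \ E, (h y z : 𝕜) * (f (b y) - f (a y)) :=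
      (Finset.sum_inter_add_sum_sdiff _ _ _).symm
    beta_reduce
    rw [h1, h2, dist_eq_norm]
    have h3 : ‖∑ y ∈ F z \ E, (h y z : 𝕜) * (f (b y) - f (a y))‖ ≤ n * (ε / (n + 1)) := by
      refine (norm_sum_le _ _).trans ?_
      refine (Finset.sum_le_card_nsmul _ _ (ε / (n + 1)) fun y hy => ?_).trans ?_
      · obtain ⟨hyF, hyE⟩ := Finset.mem_sdiff.1 hy
        have hlt : ‖f (b y) - f (a y)‖ < ε / (n + 1) := not_le.1 fun hle =>
          hyE ((hE y).2 ⟨Or.inr hle, ((hF z y).1 hyF).1⟩)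
        rw [norm_mul, RCLike.norm_ofReal]
        exact (mul_le_of_le_one_left (norm_nonneg _) (hbound y z)).trans hlt.le
      · rw [nsmul_eq_mul]
        gcongr
        exact (Finset.card_le_card Finset.sdiff_subset).trans (hcard z)
    have h4 : n * (ε / (n + 1)) < ε := by
      rw [mul_div_assoc', div_lt_iff₀ (by positivity)]
      nlinarith
    refine lt_of_le_of_lt (le_of_eq ?_) (h3.trans_lt h4)
    rw [← norm_neg]
    congr 1
    ring

/-- If `Q` is empty, then `q` has a continuous section. -/
theorem exists_continuous_section [CompactSpace K] {q : C(K, L)} (hmono : Monotone q)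
    (hsurj : Function.Surjective q) (hQ : internalNontrivialFibers q = ∅) :
    ∃ i : C(L, K), ∀ x, q (i x) = x := by
  classical
  choose a ha using exists_isLeast_fiber q hsurj
  choose b hb using exists_isGreatest_fiber q hsurj
  have hi : ∀ x, q (if 𝓝[>] x = ⊥ then a x else b x) = x := fun x => by
    split_ifs
    · exact (ha x).1
    · exact (hb x).1
  refine ⟨⟨fun x => if 𝓝[>] x = ⊥ then a x else b x, continuous_iff_continuousAt.2 fun x => ?_⟩,
    hi⟩
  exact continuousAt_section hmono hi ha hb (by simp [hQ]) (fun h => if_pos h) fun h => if_neg h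

/-- The upper estimate for the norm of a projection. -/
theorem exists_isProjectionOnto_of_order_lt [CompactSpace K] [CompactSpace L] (𝕜 : Type*)
    [RCLike 𝕜] {q : C(K, L)} (hmono : Monotone q) (hsurj : Function.Surjective q) {n : ℕ}
    (hn : ∀ x, ¬ PointOrderGE (internalNontrivialFibers q) n x) :
    ∃ P : C(K, 𝕜) →L[𝕜] C(K, 𝕜), IsProjectionOnto P (pullback 𝕜 q) ∧ ‖P‖ ≤ 2 * n + 1 := by
  classical
  set A := internalNontrivialFibers q with hA
  choose a ha using exists_isLeast_fiber q hsurj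
  choose b hb using exists_isGreatest_fiber q hsurj
  have hqa : ∀ x, q (a x) = x := fun x => (ha x).1
  have hqb : ∀ x, q (b x) = x := fun x => (hb x).1
  obtain ⟨c, hc, lev, hlev, hdisj⟩ := exists_intervals_of_order_lt (A := A) (fun x hx => hx.1) hn
  have hjf : ∀ x, ∃ h : L → ℝ, (∀ z, h z ≠ 0 → z ∈ Ioo x (c x) ∪ Ioo (c x) x) ∧
      (∀ z, |h z| ≤ 1) ∧ (∀ y, y ≠ x → ContinuousAt h y) ∧ (x ∈ A →
      (x < c x → Tendsto h (𝓝[<] x) (𝓝 0) ∧ Tendsto h (𝓝[>] x) (𝓝 1)) ∧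
      (c x < x → Tendsto h (𝓝[<] x) (𝓝 (-1)) ∧ Tendsto h (𝓝[>] x) (𝓝 0))) := fun x => by
    by_cases hx : x ∈ A
    · obtain ⟨h, h1, h2, h3, h4⟩ := exists_jump_function (hc x hx)
      exact ⟨h, h1, h2, h3, fun _ => h4⟩
    · exact ⟨0, by simp, by simp, fun y _ => continuousAt_const, fun h => (hx h).elim⟩
  choose h hsupp hbound hcont hjump using hjf
  -- On `A` the section takes the extreme value matching the side without correction: `a x` if the
  -- support lies to the right, `b x` if it lies to the left. Elsewhere it follows
  -- `continuousAt_section`.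
  let i : L → K := fun x => if (x ∈ A ∧ x < c x) ∨ (x ∉ A ∧ 𝓝[>] x = ⊥) then a x else b x
  have hi : ∀ x, q (i x) = x := fun x => by
    simp only [i]
    split_ifs
    · exact hqa x
    · exact hqb x
  -- Supports of equal level are disjoint, so the points whose corrections act at `z` have distinct
  -- levels below `n`.
  have hinj : ∀ z, InjOn lev {y | y ∈ A ∧ h y z ≠ 0} := fun z y hy y' hy' hyy' => by
    by_contra hne
    exact Set.disjoint_left.1 (hdisj y hy.1 y' hy'.1 hyy' hne) (hsupp y z hy.2)
      (hsupp y' z hy'.2)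
  have hmaps : ∀ z, MapsTo lev {y | y ∈ A ∧ h y z ≠ 0} (Finset.range n : Finset ℕ) :=
    fun z y hy => by simpa using hlev y hy.1
  have hfin : ∀ z, {y | y ∈ A ∧ h y z ≠ 0}.Finite := fun z =>
    Set.Finite.of_injOn (hmaps z) (hinj z) (Finset.finite_toSet _)
  let F : L → Finset L := fun z => (hfin z).toFinset
  have hF : ∀ z y, y ∈ F z ↔ y ∈ A ∧ h y z ≠ 0 := fun z y => by simp [F]
  have hcard : ∀ z, (F z).card ≤ n := fun z => by
    have := Finset.card_le_card_of_injOn (s := F z) (t := Finset.range n) lev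
      (fun y hy => hmaps z ((hF z y).1 hy))
      (fun y hy y' hy' => hinj z ((hF z y).1 hy) ((hF z y').1 hy'))
    simpa using this
  have hiA : ∀ x ∉ A, ContinuousAt i x := fun x hx =>
    continuousAt_section hmono hi ha hb hx (fun hbot => if_pos (Or.inr ⟨hx, hbot⟩))
      fun hbot => if_neg (by simp [hx, hbot])
  have hzero : ∀ y, h y y = 0 := fun y => by
    by_contra hne
    simpa using hsupp y y hne
  have hside : ∀ x ∈ A, (i x = a x ∧ Tendsto (h x) (𝓝[<] x) (𝓝 0) ∧
        Tendsto (h x) (𝓝[>] x) (𝓝 1)) ∨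
      (i x = b x ∧ Tendsto (h x) (𝓝[<] x) (𝓝 (-1)) ∧ Tendsto (h x) (𝓝[>] x) (𝓝 0)) :=
    fun x hx => by
      rcases lt_or_gt_of_ne (hc x hx) with hlt | hlt
      · exact Or.inr ⟨if_neg (by simp [hx, hlt.le]), (hjump x hx).2 hlt⟩
      · exact Or.inl ⟨if_pos (Or.inl ⟨hx, hlt⟩), (hjump x hx).1 hlt⟩
  let T : C(K, 𝕜) →ₗ[𝕜] C(L, 𝕜) :=
    { toFun := fun f => ⟨fun z => f (i z) - ∑ y ∈ F z, (h y z : 𝕜) * (f (b y) - f (a y)),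
        continuous_corrected_section hmono ha hb hi hiA hbound hcont hzero hside hF hcard f⟩
      map_add' := fun f g => by
        ext z
        simp only [ContinuousMap.add_apply, ContinuousMap.coe_mk]
        rw [sub_add_sub_comm, ← Finset.sum_add_distrib]
        congr 1
        exact Finset.sum_congr rfl fun y _ => by ring
      map_smul' := fun r f => by
        ext z
        simp only [ContinuousMap.smul_apply, ContinuousMap.coe_mk, smul_eq_mul, RingHom.id_apply]
        rw [mul_sub, Finset.mul_sum]
        congr 1
        exact Finset.sum_congr rfl fun y _ => by ring }
  have hTapp : ∀ f z, T f z = f (i z) - ∑ y ∈ F z, (h y z : 𝕜) * (f (b y) - f (a y)) :=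
    fun _ _ => rfl
  refine exists_isProjectionOnto (T := T) (fun g => ?_) (by positivity) fun f z => ?_
  · ext z
    simp [hTapp, hi, hqa, hqb]
  · rw [hTapp]
    have hsum : ‖∑ y ∈ F z, (h y z : 𝕜) * (f (b y) - f (a y))‖ ≤ n * (2 * ‖f‖) := by
      refine (norm_sum_le _ _).trans ?_
      refine (Finset.sum_le_card_nsmul _ _ (2 * ‖f‖) fun y _ => ?_).trans ?_
      · rw [norm_mul, RCLike.norm_ofReal]
        refine (mul_le_of_le_one_left (norm_nonneg _) (hbound y z)).trans ?_
        refine (norm_sub_le _ _).trans ?_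
        linarith [f.norm_coe_le_norm (b y), f.norm_coe_le_norm (a y)]
      · rw [nsmul_eq_mul]
        gcongr
        exact hcard z
    refine (norm_sub_le _ _).trans ?_
    linarith [f.norm_coe_le_norm (i z)]

end Operator

/-- Composition with a continuous section is a regular averaging operator. -/
theorem exists_isRegularAveraging (𝕜 : Type*) [RCLike 𝕜] {K L : Type*}
    [TopologicalSpace K] [CompactSpace K] [TopologicalSpace L] [CompactSpace L] {q : C(K, L)} {i : C(L, K)} (hi : ∀ x, q (i x) = x) :
    ∃ T : C(K, 𝕜) →L[𝕜] C(L, 𝕜), IsRegularAveraging q T := by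
  refine ⟨⟨(ContinuousMap.compRightAlgHom 𝕜 𝕜 i).toLinearMap, i.continuous_precomp⟩, fun f => ?_, rfl,
    fun f hf x => hf (i x)⟩
  ext x
  exact congrArg f (hi x)

end CompactLine

/-! ### Assembly of the two estimates -/

theorem mainTheorem1 (𝕜 : Type*) [RCLike 𝕜] {K L : Type*}
    [LinearOrder K] [TopologicalSpace K] [OrderTopology K] [CompactSpace K]
    [LinearOrder L] [TopologicalSpace L] [OrderTopology L] [CompactSpace L]
    (q : C(K, L)) (hmono : Monotone q) (hsurj : Function.Surjective q)
    (Q : Set L) (hQ : Q = CompactLine.internalNontrivialFibers q) :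
    -- 1.
    (CompactLine.IsComplementedWith 1 (CompactLine.pullback 𝕜 q) ↔ Q = ∅) ∧
    (Q = ∅ →
      (∃ i : C(L, K), ∀ x, q (i x) = x) ∧
      ∃ T : C(K, 𝕜) →L[𝕜] C(L, 𝕜), CompactLine.IsRegularAveraging q T) ∧
    -- 2.
    (CompactLine.IsComplemented (CompactLine.pullback 𝕜 q) ↔
      CompactLine.internalOrder Q < ⊤) ∧
    -- 2 (a)
    (Nonempty K → ∀ n : ℤ, (n : WithTop ℤ) ≤ CompactLine.internalOrder Q →
      ∀ P : C(K, 𝕜) →L[𝕜] C(K, 𝕜),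
        CompactLine.IsProjectionOnto P (CompactLine.pullback 𝕜 q) →
          2 + (⌈((n : ℝ) - 1) / 2⌉ : ℝ) ≤ ‖P‖) ∧
    -- 2 (b)
    (∀ n : ℤ, CompactLine.internalOrder Q ≤ (n : WithTop ℤ) →
      ∃ P : C(K, 𝕜) →L[𝕜] C(K, 𝕜),
        CompactLine.IsProjectionOnto P (CompactLine.pullback 𝕜 q) ∧
          ‖P‖ ≤ 2 * (n : ℝ) + 3) := by
  subst hQ
  have upper : ∀ n : ℤ,
      CompactLine.internalOrder (CompactLine.internalNontrivialFibers q) ≤ (n : WithTop ℤ) →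
      ∃ P : C(K, 𝕜) →L[𝕜] C(K, 𝕜),
        CompactLine.IsProjectionOnto P (CompactLine.pullback 𝕜 q) ∧
          ‖P‖ ≤ 2 * (n : ℝ) + 3 := by
    intro n hn
    have hn1 : -1 ≤ n := by
      exact_mod_cast (CompactLine.neg_one_le_internalOrder _).trans hn
    -- Order at most `n` means that no point has order `m = n + 1`, and `2 * m + 1 = 2 * n + 3`.
    obtain ⟨m, hm⟩ := Int.eq_ofNat_of_zero_le (show 0 ≤ n + 1 by omega)
    obtain ⟨P, hP, hPn⟩ := CompactLine.exists_isProjectionOnto_of_order_lt 𝕜 hmono hsurj (n := m)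
      (fun x hx => by
        have : (m : ℤ) ≤ n := by
          exact_mod_cast (CompactLine.natCast_le_internalOrder_iff.2 ⟨x, hx⟩).trans hn
        omega)
    refine ⟨P, hP, hPn.trans (le_of_eq ?_)⟩
    have : (n : ℝ) + 1 = m := by exact_mod_cast hm
    rw [← this]
    ring
  refine ⟨⟨?_, fun h => ?_⟩, fun h => ?_, ⟨?_, fun h => ?_⟩, ?_, upper⟩
  · rintro ⟨P, hP, hPn⟩
    refine Set.eq_empty_of_forall_notMem fun x hx => ?_
    -- A point of `Q` has order at least `0`, which already forces norm at least `2`.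
    have := hP.add_two_le_norm hmono hsurj (n := 0) (x := x) hx
    norm_num at this
    linarith
  · obtain ⟨P, hP, hPn⟩ := upper (-1) (by simp [CompactLine.internalOrder, h])
    exact ⟨P, hP, hPn.trans (by norm_num)⟩
  · obtain ⟨i, hi⟩ := CompactLine.exists_continuous_section hmono hsurj h
    exact ⟨⟨i, hi⟩, CompactLine.exists_isRegularAveraging 𝕜 hi⟩
  · rintro ⟨P, hP⟩
    refine lt_top_iff_ne_top.2 fun htop => ?_
    obtain ⟨n, hn⟩ := exists_nat_gt ‖P‖
    obtain ⟨x, hx⟩ := CompactLine.natCast_le_internalOrder_iff.1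
      (show (((n : ℤ)) : WithTop ℤ) ≤ _ from htop ▸ le_top)
    have := hP.add_two_le_norm hmono hsurj hx
    linarith
  · obtain ⟨n, hn⟩ := WithTop.ne_top_iff_exists.1 h.ne
    obtain ⟨P, hP, -⟩ := upper n hn.ge
    exact ⟨P, hP⟩
  · intro hK n hn P hP
    -- For negative `n` the claimed bound is at most `1`, and a projection fixing the nonzero
    -- function `1` has norm at least `1`.
    rcases lt_or_ge n 0 with hneg | hpos
    · have hceil : ⌈((n : ℝ) - 1) / 2⌉ ≤ -1 := by
        rw [Int.ceil_le]
        have : (n : ℝ) ≤ -1 := by exact_mod_cast (show n ≤ -1 by omega)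
        push_cast
        linarith
      have : (⌈((n : ℝ) - 1) / 2⌉ : ℝ) ≤ -1 := by exact_mod_cast hceil
      linarith [hP.one_le_norm]
    · obtain ⟨m, rfl⟩ := Int.eq_ofNat_of_zero_le hpos
      obtain ⟨x, hx⟩ := CompactLine.natCast_le_internalOrder_iff.1 hn
      have h1 := hP.add_two_le_norm hmono hsurj hx
      -- The bound `m + 2` is at least the required one, since `(m - 1) / 2 ≤ m`.
      have hceil : ⌈(((m : ℤ) : ℝ) - 1) / 2⌉ ≤ (m : ℤ) := by
        rw [Int.ceil_le]
        have : (0 : ℝ) ≤ ((m : ℤ) : ℝ) := by positivity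
        linarith
      have : (⌈(((m : ℤ) : ℝ) - 1) / 2⌉ : ℝ) ≤ m := by exact_mod_cast hceil
      linarith
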